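/- Let $n\ge 2$, let $\mathbb R^n$ carry the Euclidean metric and Lebesgue measure, and put $B(x_0,r)=\{|x-x_0|<r\}$, $\mathbb B^n=B(0,1)$, $D=\mathbb B^n\setminus\{0\}$, $A(x_0,r_1,r_2)=\{r_1<|x-x_0|<r_2\}$. The $n$-modulus of a family $\Gamma$ of curves (continuous maps of compact intervals into $\mathbb R^n$) is $M_n(\Gamma)=\inf_\rho\int_{\mathbb R^n}\rho^n\,dm$, where the infimum is over all Borel $\rho:\mathbb R^n\to[0,\infty]$ with $\int_\gamma\rho\,|dx|\ge 1$ for every rectifiable $\gamma\in\Gamma$ ($M_n(\Gamma)=\infty$ if there is no such $\rho$). For $E,F\subset\mathbb R^n$ let $\Gamma(E,F,D)$ be the family of all curves $\gamma:[a,b]\to\mathbb R^n$ with $\gamma(a)\in E$, $\gamma(b)\in F$ and $\gamma(t)\in D$ for $a<t<b$. Let $Q:\mathbb B^n\to[0,\infty]$ be measurable, extended by $0$ outside $D$. A homeomorphism $g$ of $D$ onto its image in $\mathbb R^n$ is called a ring $Q$-homeomorphism at the boundary point $0$ of $D$ if there is $r_0>0$ such that for all $0<r_1<r_2<r_0$,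 all continua $E_1\subset\overline{B(0,r_1)}\cap D$ and $E_2\subset(\mathbb R^n\setminus B(0,r_2))\cap D$, and all measurable $\eta:(r_1,r_2)\to[0,\infty]$ with $\int_{r_1}^{r_2}\eta(r)\,dr\ge1$, $$M_n\bigl(g(\Gamma(E_1,E_2,D))\bigr)\le\int_{A(0,r_1,r_2)}Q(x)\,\eta^n(|x|)\,dm(x).$$ **Theorem.** For every $n\ge2$ and every real $p\ge1$ there exist a function $Q:\mathbb B^n\to[1,\infty]$ with $Q\in L^p(\mathbb B^n)$ and a sequence $g_m:D\to\mathbb R^n$, $m=1,2,\dots$, of ring $Q$-homeomorphisms at $0$ (with the same $Q$ for all $m$) such that every $g_m$ has a continuous extension to the point $0$, but the family $\{g_m\}_{m=1}^\infty$ of the extended maps is not equicontinuous at $0$. Moreover, the $g_m$ can be taken to map $D$ onto $B(0,2)\setminus\{0\}$ and to be the radial stretches $$g_m(x)=\begin{cases}\dfrac{1+|x|^{\alpha}}{|x|}\,x,&1/m\le|x|<1,\\[2mm]\dfrac{1+(1/m)^{\alpha}}{1/m}\,x,&0<|x|<1/m,\end{cases}$$ for some $\alpha\in(0,1)$ that does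 not depend on $m$. -/

import Mathlib

open Set Filter Topology MeasureTheory
open scoped ENNReal

noncomputable section

namespace RingHomeo

/-- A curve in `X`: a continuous map of a compact interval `[a, b]` into `X`
(only the values on `[a, b]` matter). -/
structure Curve (X : Type*) [TopologicalSpace X] where
  a : ℝ
  b : ℝ
  le : a ≤ b
  toFun : ℝ → X
  cont : ContinuousOn toFun (Icc a b)

/-- The length of a curve: the supremum of the lengths of inscribed polygons. -/
def Curve.length {X : Type*} [PseudoEMetricSpace X] (γ : Curve X) : ℝ≥0∞ :=
  eVariationOn γ.toFun (Icc γ.a γ.b)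

/-- The normal representation `γ⁰ : [0, l(γ)] → X` of a rectifiable curve, i.e. its
parametrization by arc length: `γ t = γ⁰ (s t)`, where `s t` is the length of `γ` on `[a, t]`. -/
def Curve.normalRep {X : Type*} [PseudoEMetricSpace X] (γ : Curve X) : ℝ → X :=
  naturalParameterization γ.toFun (Icc γ.a γ.b) γ.a

/-- The integral of `ρ` along a rectifiable curve with respect to arc length. -/
def Curve.lineIntegral {X : Type*} [PseudoEMetricSpace X] (γ : Curve X) (ρ : X → ℝ≥0∞) : ℝ≥0∞ :=
  ∫⁻ t in Icc 0 γ.length.toReal, ρ (γ.normalRep t)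

/-- `ρ` is admissible for the family `Γ`: it is Borel and every rectifiable curve
of `Γ` has `ρ`-length at least `1`. -/
def Admissible {X : Type*} [PseudoEMetricSpace X] [MeasurableSpace X]
    (Γ : Set (Curve X)) (ρ : X → ℝ≥0∞) : Prop :=
  Measurable ρ ∧ ∀ γ ∈ Γ, γ.length ≠ ∞ → 1 ≤ γ.lineIntegral ρ

/-- The `p`-modulus of a family of curves (equal to `∞` if no function is admissible). -/
def modulus {X : Type*} [PseudoEMetricSpace X] [MeasureSpace X]
    (p : ℝ) (Γ : Set (Curve X)) : ℝ≥0∞ :=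
  ⨅ (ρ : X → ℝ≥0∞) (_ : Admissible Γ ρ), ∫⁻ x, ρ x ^ p

/-- `Γ(E, F, D)`: the curves that join `E` and `F` in `D`. -/
def joining {X : Type*} [TopologicalSpace X] (E F D : Set X) : Set (Curve X) :=
  {γ | γ.toFun γ.a ∈ E ∧ γ.toFun γ.b ∈ F ∧ ∀ t ∈ Ioo γ.a γ.b, γ.toFun t ∈ D}

/-- `f(Γ)`: the family of the curves `f ∘ γ` with `γ ∈ Γ`. -/
def imageFamily {X Y : Type*} [TopologicalSpace X] [TopologicalSpace Y]
    (f : X → Y) (Γ : Set (Curve X)) : Set (Curve Y) :=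
  {β | ∃ γ ∈ Γ, β.a = γ.a ∧ β.b = γ.b ∧ ∀ t ∈ Icc γ.a γ.b, β.toFun t = f (γ.toFun t)}

/-- A continuum: a (nonempty) connected compact set. -/
def IsContinuum {X : Type*} [TopologicalSpace X] (E : Set X) : Prop :=
  IsCompact E ∧ IsConnected E

/-- The open ring `A(x₀, r₁, r₂)`. -/
def openRing {X : Type*} [PseudoMetricSpace X] (x₀ : X) (r₁ r₂ : ℝ) : Set X :=
  {x | r₁ < dist x x₀ ∧ dist x x₀ < r₂}

/-- `f : D → Y` is a ring `(p, q, Q)`-mapping at the boundary point `x₀ ∈ ∂D`.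
The weight `Q` is understood to vanish outside `D`, hence the integral over `A ∩ D`;
`η` ranges over all Lebesgue measurable functions on `(r₁, r₂)` of integral at least `1`. -/
def IsRingMapAt {X Y : Type*} [PseudoMetricSpace X] [MeasureSpace X]
    [PseudoMetricSpace Y] [MeasureSpace Y]
    (p q : ℝ) (Q : X → ℝ≥0∞) (D : Set X) (f : X → Y) (x₀ : X) : Prop :=
  x₀ ∈ frontier D ∧
  ∃ r₀ : ℝ, 0 < r₀ ∧ ∀ r₁ r₂ : ℝ, 0 < r₁ → r₁ < r₂ → r₂ < r₀ →
    ∀ E₁ E₂ : Set X, IsContinuum E₁ → IsContinuum E₂ →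
      E₁ ⊆ closure (Metric.ball x₀ r₁) ∩ D → E₂ ⊆ (Metric.ball x₀ r₂)ᶜ ∩ D →
      ∀ η : ℝ → ℝ≥0∞, AEMeasurable η (volume.restrict (Ioo r₁ r₂)) →
        1 ≤ ∫⁻ r in Ioo r₁ r₂, η r →
        modulus p (imageFamily f (joining E₁ E₂ D)) ≤
          ∫⁻ x in openRing x₀ r₁ r₂ ∩ D, Q x * η (dist x x₀) ^ q

/-- `f` maps `D ⊆ ℝⁿ` homeomorphically onto its image and is a ring `Q`-mapping at the
boundary point `x₀`, with both exponents equal to `n` and with Lebesgue measure. -/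
def IsRingQHomeoAt {n : ℕ} (Q : EuclideanSpace ℝ (Fin n) → ℝ≥0∞)
    (D : Set (EuclideanSpace ℝ (Fin n)))
    (f : EuclideanSpace ℝ (Fin n) → EuclideanSpace ℝ (Fin n))
    (x₀ : EuclideanSpace ℝ (Fin n)) : Prop :=
  IsEmbedding (D.domRestrict f) ∧ IsRingMapAt (n : ℝ) (n : ℝ) Q D f x₀

/-- The punctured unit ball. -/
def puncturedBall (n : ℕ) : Set (EuclideanSpace ℝ (Fin n)) :=
  Metric.ball 0 1 \ {0}

/-- The radial stretch equal to `(1 + |x|^α) x / |x|` for `|x| ≥ 1 / m` and linear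
for `|x| < 1 / m`. -/
def radialStretch {n : ℕ} (α : ℝ) (m : ℕ+) (x : EuclideanSpace ℝ (Fin n)) :
    EuclideanSpace ℝ (Fin n) :=
  if 1 / (m : ℝ) ≤ ‖x‖ then ((1 + ‖x‖ ^ α) / ‖x‖) • x
  else ((1 + (1 / (m : ℝ)) ^ α) / (1 / (m : ℝ))) • x

end RingHomeo

end

/-! A radial map with increasing profile `f` distorts the modulus of a ring in a way that can be
computed. Given `η` on `(r₁, r₂)`, transport it to the image by `ψ (f r) = η r / f' r`. Then `ψ |y|`
is admissible for the image family: along a curve, `|y|` is 1-Lipschitz in arc length and runs from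
at most `f r₁` to at least `f r₂`, so the line integral is at least `∫ ψ = ∫ η ≥ 1`. In polar
coordinates the integral of `ψ |y| ^ n` becomes that of `(f r / (r f' r)) ^ (n - 1) * η r ^ n`, so
any `Q` above this inner dilatation serves (`isRingMapAt_of_radial`).

For the stretches the dilatation is 1 inside radius `1 / m`, where the map is linear, and `((1 + r ^
α) / (α r ^ α)) ^ (n - 1)` outside. Both are at most `(2 / (α r ^ α)) ^ (n - 1)`, which does not
involve `m` and is in `L^p` for `α = 1 / (2p)`. Yet each map fixes 0 and sends the sphere of radius
`1 / m` outside the unit ball, so equicontinuity fails. -/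

namespace RingHomeo


/-! ### Radial integrals and 1-Lipschitz changes of variable -/

/-- Polar coordinates for the Lebesgue integral of a radial function. -/
theorem lintegral_fun_norm_addHaar {E : Type*} [NormedAddCommGroup E] [NormedSpace ℝ E]
    [FiniteDimensional ℝ E] [MeasurableSpace E] [BorelSpace E] [Nontrivial E]
    (μ : Measure E) [μ.IsAddHaarMeasure] {h : ℝ → ℝ≥0∞} (hh : Measurable h) :
    ∫⁻ x, h ‖x‖ ∂μ = μ.toSphere univ *
      ∫⁻ r in Ioi (0 : ℝ), ENNReal.ofReal (r ^ (Module.finrank ℝ E - 1)) * h r := by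
  calc
    ∫⁻ x, h ‖x‖ ∂μ = ∫⁻ x : ({(0)}ᶜ : Set E), h ‖x.1‖ ∂(μ.comap (↑)) := by
      rw [lintegral_subtype_comap (measurableSet_singleton _).compl fun x ↦ h ‖x‖,
        restrict_compl_singleton]
    _ = ∫⁻ x, h x.2 ∂μ.toSphere.prod (.volumeIoiPow (Module.finrank ℝ E - 1)) := by
      simpa using μ.measurePreserving_homeomorphUnitSphereProd.lintegral_comp_emb
        (Homeomorph.measurableEmbedding _) (h ∘ Subtype.val ∘ Prod.snd)
    _ = μ.toSphere univ *
        ∫⁻ r : Ioi (0 : ℝ), h r ∂.volumeIoiPow (Module.finrank ℝ E - 1) := by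
      rw [lintegral_prod _ (by fun_prop)]
      simp [mul_comm]
    _ = _ := by
      rw [Measure.volumeIoiPow, lintegral_withDensity_eq_lintegral_mul _ (by fun_prop) (by fun_prop)]
      congr 1
      exact lintegral_subtype_comap measurableSet_Ioi
        fun r ↦ ENNReal.ofReal (r ^ (Module.finrank ℝ E - 1)) * h r

/-- A `1`-Lipschitz function does not decrease the integral over the values that it takes. -/
theorem setLIntegral_le_setLIntegral_comp_of_lipschitzOnWith_one {u : ℝ → ℝ} {s t : Set ℝ}
    (hs : MeasurableSet s) (hu : LipschitzOnWith 1 u s)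
    (hst : t ⊆ u '' s) {ψ : ℝ → ℝ≥0∞} (hψ : Measurable ψ) :
    ∫⁻ x in t, ψ x ≤ ∫⁻ x in s, ψ (u x) := by
  obtain ⟨v, hv, huv⟩ := hu.extend_real
  have hvm : Measurable v := hv.continuous.measurable
  calc
    ∫⁻ x in t, ψ x ≤ ∫⁻ x, ψ x ∂(volume.restrict s).map v := by
      -- It is enough to compare Lebesgue measure on `t` with the push-forward of Lebesgue measure
      -- on `s`. This holds because a 1-Lipschitz map does not increase one-dimensional Hausdorff
      -- measure, which on the line is Lebesgue measure.
      refine lintegral_mono' (Measure.le_iff.2 fun A hA ↦ ?_) le_rfl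
      rw [Measure.restrict_apply hA, Measure.map_apply hvm hA,
        Measure.restrict_apply (hvm hA)]
      calc
        volume (A ∩ t) ≤ volume (v '' (v ⁻¹' A ∩ s)) := by
          refine measure_mono ?_
          rintro y ⟨hyA, hyt⟩
          obtain ⟨x, hx, rfl⟩ := hst hyt
          exact ⟨x, ⟨by rwa [mem_preimage, ← huv hx], hx⟩, (huv hx).symm⟩
        _ ≤ volume (v ⁻¹' A ∩ s) := by
          simpa [hausdorffMeasure_real] using
            hv.hausdorffMeasure_image_le zero_le_one (v ⁻¹' A ∩ s)
    _ = ∫⁻ x in s, ψ (v x) := lintegral_map hψ hvm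
    _ = ∫⁻ x in s, ψ (u x) :=
      setLIntegral_congr_fun hs fun x hx ↦ by simp only [huv hx]

/-! ### Arc length and line integrals along rectifiable curves -/

namespace Curve

variable {X : Type*} [PseudoEMetricSpace X] (γ : Curve X)

theorem left_mem : γ.a ∈ Icc γ.a γ.b := left_mem_Icc.2 γ.le

theorem right_mem : γ.b ∈ Icc γ.a γ.b := right_mem_Icc.2 γ.le

/-- The length of the part of a curve from its origin to a given parameter. -/
noncomputable def arcLength (t : ℝ) : ℝ :=
  variationOnFromTo γ.toFun (Icc γ.a γ.b) γ.a t

variable {γ}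

theorem boundedVariationOn (h : γ.length ≠ ∞) : BoundedVariationOn γ.toFun (Icc γ.a γ.b) := h

theorem arcLength_sub {s t : ℝ} (h : γ.length ≠ ∞) (hs : s ∈ Icc γ.a γ.b)
    (ht : t ∈ Icc γ.a γ.b) :
    γ.arcLength t - γ.arcLength s = variationOnFromTo γ.toFun (Icc γ.a γ.b) s t :=
  variationOnFromTo.sub_right (boundedVariationOn h).locallyBoundedVariationOn γ.left_mem ht hs

theorem arcLength_left : γ.arcLength γ.a = 0 := variationOnFromTo.self _ _ _

theorem arcLength_right : γ.arcLength γ.b = γ.length.toReal := by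
  rw [arcLength, variationOnFromTo.eq_of_le _ _ γ.le, inter_self, length]

/-- At a point where a function of bounded variation is continuous, its variation over one-sided
intervals shrinking to the point tends to 0. The increment of arc length is the variation on one of
the two sides, hence at most their sum. -/
theorem continuousOn_arcLength (h : γ.length ≠ ∞) :
    ContinuousOn γ.arcLength (Icc γ.a γ.b) := by
  intro x hx
  have hl := (boundedVariationOn h).tendsto_eVariationOn_Icc_zero_left
    ((γ.cont x hx).mono inter_subset_left)
  have hr := (boundedVariationOn h).tendsto_eVariationOn_Icc_zero_right x
    ((γ.cont x hx).mono inter_subset_left)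
  have hsum := (ENNReal.tendsto_toReal (by simp)).comp (hl.add hr)
  rw [ContinuousWithinAt, tendsto_iff_dist_tendsto_zero]
  simp only [add_zero, ENNReal.toReal_zero] at hsum
  refine squeeze_zero' (Eventually.of_forall fun _ ↦ dist_nonneg) ?_ hsum
  have hfin : ∀ c d, eVariationOn γ.toFun (Icc γ.a γ.b ∩ Icc c d) ≠ ∞ := fun c d ↦
    (boundedVariationOn h).mono inter_subset_left
  filter_upwards [self_mem_nhdsWithin] with y hy
  rw [Real.dist_eq, arcLength_sub h hx hy, Function.comp, ENNReal.toReal_add (hfin _ _) (hfin _ _)]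
  rcases le_total x y with hxy | hxy
  · rw [abs_of_nonneg (variationOnFromTo.nonneg_of_le _ _ hxy), variationOnFromTo.eq_of_le _ _ hxy]
    exact le_add_of_nonneg_left ENNReal.toReal_nonneg
  · rw [abs_of_nonpos (variationOnFromTo.nonpos_of_ge _ _ hxy),
      variationOnFromTo.eq_of_ge _ _ hxy, neg_neg]
    exact le_add_of_nonneg_right ENNReal.toReal_nonneg

theorem image_arcLength (h : γ.length ≠ ∞) :
    γ.arcLength '' Icc γ.a γ.b = Icc 0 γ.length.toReal := by
  refine Subset.antisymm ?_ ?_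
  · rintro _ ⟨t, ht, rfl⟩
    have hm := variationOnFromTo.monotoneOn
      (boundedVariationOn h).locallyBoundedVariationOn γ.left_mem
    exact ⟨variationOnFromTo.nonneg_of_le _ _ ht.1,
      (hm ht γ.right_mem ht.2).trans_eq arcLength_right⟩
  · have := intermediate_value_Icc γ.le (continuousOn_arcLength h)
    rwa [arcLength_left, arcLength_right] at this

theorem edist_normalRep_arcLength {t : ℝ} (h : γ.length ≠ ∞) (ht : t ∈ Icc γ.a γ.b) :
    edist (γ.normalRep (γ.arcLength t)) (γ.toFun t) = 0 :=
  edist_naturalParameterization_eq_zero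
    (boundedVariationOn h).locallyBoundedVariationOn γ.left_mem ht

/-- Unit speed means that the variation over `[x, y]` is `y - x`, and the variation dominates the
distance of the endpoints. -/
theorem lipschitzOnWith_normalRep (h : γ.length ≠ ∞) :
    LipschitzOnWith 1 γ.normalRep (Icc 0 γ.length.toReal) := by
  have hu := has_unit_speed_naturalParameterization γ.toFun
    (boundedVariationOn h).locallyBoundedVariationOn γ.left_mem
  change HasUnitSpeedOn γ.normalRep (γ.arcLength '' Icc γ.a γ.b) at hu
  rw [image_arcLength h] at hu
  have key : ∀ x ∈ Icc 0 γ.length.toReal, ∀ y ∈ Icc 0 γ.length.toReal, x ≤ y →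
      edist (γ.normalRep x) (γ.normalRep y) ≤ edist x y := by
    intro x hx y hy hxy
    calc
      _ ≤ eVariationOn γ.normalRep (Icc 0 γ.length.toReal ∩ Icc x y) :=
        eVariationOn.edist_le _ ⟨hx, left_mem_Icc.2 hxy⟩ ⟨hy, right_mem_Icc.2 hxy⟩
      _ = ENNReal.ofReal (y - x) := by simpa using hu hx hy
      _ = edist x y := by rw [edist_comm, edist_dist, Real.dist_eq, abs_of_nonneg (sub_nonneg.2 hxy)]
  intro x hx y hy
  rw [ENNReal.coe_one, one_mul]
  rcases le_total x y with hxy | hxy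
  · exact key x hx y hy hxy
  · rw [edist_comm, edist_comm x]
    exact key y hy x hx hxy

/-- The line integral of `ψ ∘ d` for a `1`-Lipschitz function `d` is at least the integral of `ψ`
between the values of `d` at the endpoints of the curve. -/
theorem setLIntegral_Ioo_le_lineIntegral {d : X → ℝ} (hd : LipschitzWith 1 d)
    (h : γ.length ≠ ∞) {s₁ s₂ : ℝ} (h₁ : d (γ.toFun γ.a) ≤ s₁) (h₂ : s₂ ≤ d (γ.toFun γ.b))
    {ψ : ℝ → ℝ≥0∞} (hψ : Measurable ψ) :
    ∫⁻ s in Ioo s₁ s₂, ψ s ≤ γ.lineIntegral fun x ↦ ψ (d x) := by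
  -- In a pseudometric space the normal representation recovers the curve only up to distance 0,
  -- which the Lipschitz function `d` cannot see.
  have hval : ∀ t ∈ Icc γ.a γ.b, d (γ.normalRep (γ.arcLength t)) = d (γ.toFun t) := by
    intro t ht
    have := hd (γ.normalRep (γ.arcLength t)) (γ.toFun t)
    rw [edist_normalRep_arcLength h ht, mul_zero] at this
    exact edist_le_zero.1 this
  have hlip : LipschitzOnWith 1 (fun t ↦ d (γ.normalRep t)) (Icc 0 γ.length.toReal) := by
    simpa [Function.comp_def] using (hd.lipschitzOnWith (s := univ)).comp
      (lipschitzOnWith_normalRep h) (mapsTo_univ _ _)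
  refine setLIntegral_le_setLIntegral_comp_of_lipschitzOnWith_one measurableSet_Icc hlip ?_ hψ
  have himg := intermediate_value_Icc γ.le (hd.continuous.comp_continuousOn γ.cont)
  intro s hs
  obtain ⟨t, ht, rfl⟩ := himg ⟨h₁.trans hs.1.le, hs.2.le.trans h₂⟩
  exact ⟨γ.arcLength t, image_arcLength h ▸ mem_image_of_mem _ ht, hval t ht⟩

end Curve


/-! ### Modulus estimate for radial maps -/

/-- A property of almost all radii holds on almost all spheres. -/
theorem ae_norm_of_ae {E : Type*} [NormedAddCommGroup E] [NormedSpace ℝ E]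
    [FiniteDimensional ℝ E] [MeasurableSpace E] [BorelSpace E] [Nontrivial E]
    (μ : Measure E) [μ.IsAddHaarMeasure] {P : ℝ → Prop} (hP : ∀ᵐ r : ℝ, P r) :
    ∀ᵐ x ∂μ, P ‖x‖ := by
  obtain ⟨N, hPN, hN, hN0⟩ := exists_measurable_superset_of_null (ae_iff.1 hP)
  have hint : ∫⁻ x, N.indicator 1 ‖x‖ ∂μ = 0 := by
    rw [lintegral_fun_norm_addHaar μ (measurable_one.indicator hN)]
    refine mul_eq_zero_of_right _ ((lintegral_eq_zero_iff' (by fun_prop (disch := assumption))).2 ?_)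
    filter_upwards [ae_restrict_of_ae (measure_eq_zero_iff_ae_notMem.1 hN0)] with r hr
    simp [hr]
  have hzero := (lintegral_eq_zero_iff ((measurable_one.indicator hN).comp measurable_norm)).1 hint
  filter_upwards [hzero] with x hx
  by_contra hPx
  simp [show ‖x‖ ∈ N from hPN hPx] at hx

/-- The pointwise identity behind the comparison of the moduli of a ring and of its image under
a radial map. -/
theorem ofReal_mul_pow_mul_inv_pow {n : ℕ} (hn : n ≠ 0) {r a d : ℝ} (hr : 0 < r) (ha : 0 ≤ a)
    (hd : 0 < d) (e : ℝ≥0∞) :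
    ENNReal.ofReal |d| *
        (ENNReal.ofReal (a ^ (n - 1)) * (e * (ENNReal.ofReal d)⁻¹) ^ n) =
      ENNReal.ofReal (r ^ (n - 1)) * (ENNReal.ofReal ((a / (r * d)) ^ (n - 1)) * e ^ n) := by
  obtain ⟨k, rfl⟩ := Nat.exists_eq_succ_of_ne_zero hn
  simp only [Nat.succ_eq_add_one, Nat.add_sub_cancel]
  rw [abs_of_pos hd, ← ENNReal.ofReal_inv_of_pos hd, mul_pow, ← ENNReal.ofReal_pow (by positivity),
    mul_comm (e ^ (k + 1)), ← mul_assoc, ← mul_assoc, ← mul_assoc,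
    ← ENNReal.ofReal_mul (by positivity), ← ENNReal.ofReal_mul (by positivity),
    ← ENNReal.ofReal_mul (by positivity)]
  congr 2
  rw [div_pow, mul_pow, inv_pow]
  field_simp
  ring

theorem mem_puncturedBall_iff {n : ℕ} {x : EuclideanSpace ℝ (Fin n)} :
    x ∈ puncturedBall n ↔ ‖x‖ ∈ Ioo (0 : ℝ) 1 := by
  simp [puncturedBall, and_comm]

/-- A radial map with increasing profile `f` is a ring `Q`-mapping at the origin as soon as `Q`
dominates its inner dilatation `(f r / (r f' r)) ^ (n - 1)`. -/
theorem isRingMapAt_of_radial {n : ℕ} (hn : n ≠ 0) {f : ℝ → ℝ} {S : Set ℝ} (hS : S.Countable)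
    {g : EuclideanSpace ℝ (Fin n) → EuclideanSpace ℝ (Fin n)}
    {Q : EuclideanSpace ℝ (Fin n) → ℝ≥0∞} {q : ℝ → ℝ≥0∞}
    (hg : ∀ x ∈ puncturedBall n, ‖g x‖ = f ‖x‖)
    (hf0 : ∀ r ∈ Ioo (0 : ℝ) 1, 0 < f r) (hmono : StrictMonoOn f (Ioo 0 1))
    (hdiff : ∀ r ∈ Ioo (0 : ℝ) 1 \ S, DifferentiableAt ℝ f r)
    (hderiv : ∀ r ∈ Ioo (0 : ℝ) 1 \ S, 0 < deriv f r)
    (hq : Measurable q) (hQ : ∀ x ∈ puncturedBall n, q ‖x‖ ≤ Q x)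
    (hdil : ∀ r ∈ Ioo (0 : ℝ) 1 \ S,
      ENNReal.ofReal ((f r / (r * deriv f r)) ^ (n - 1)) ≤ q r) :
    IsRingMapAt (n : ℝ) (n : ℝ) Q (puncturedBall n) g 0 := by
  have : Nonempty (Fin n) := ⟨⟨0, Nat.pos_of_ne_zero hn⟩⟩
  refine ⟨?_, 1, one_pos, ?_⟩
  · refine ⟨?_, fun h ↦ (interior_subset h).2 rfl⟩
    have h : (0 : EuclideanSpace ℝ (Fin n)) ∈ closure {0}ᶜ := by simp
    simpa [puncturedBall, sdiff_eq] using
      Metric.isOpen_ball.inter_closure ⟨Metric.mem_ball_self one_pos, h⟩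
  intro r₁ r₂ hr₁ hr₁₂ hr₂ E₁ E₂ _ _ hE₁ hE₂ η hη hη1
  have hr₁01 : r₁ ∈ Ioo (0 : ℝ) 1 := ⟨hr₁, hr₁₂.trans hr₂⟩
  have hr₂01 : r₂ ∈ Ioo (0 : ℝ) 1 := ⟨hr₁.trans hr₁₂, hr₂⟩
  -- `η` is only a.e. measurable, while admissible functions must be Borel. The radii where `e`
  -- differs from `η` fill a null set of spheres, so the final integral is unaffected.
  set e := hη.mk η
  have hem : Measurable e := hη.measurable_mk
  have hee : ∀ᵐ r : ℝ, r ∈ Ioo r₁ r₂ → η r = e r := (ae_restrict_iff' measurableSet_Ioo).1 hη.ae_eq_mk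
  -- The countable set of radii where `f` may fail to be differentiable is discarded; it has measure
  -- zero.
  set T := Ioo r₁ r₂ \ S
  have hTm : MeasurableSet T := measurableSet_Ioo.diff hS.measurableSet
  have hTr : volume.restrict T = volume.restrict (Ioo r₁ r₂) :=
    Measure.restrict_congr_set (sdiff_null_ae_eq_self (hS.measure_zero _))
  have hT01 : T ⊆ Ioo 0 1 \ S := fun r hr ↦ ⟨⟨hr₁.trans hr.1.1, hr.1.2.trans hr₂⟩, hr.2⟩
  have hinj : InjOn f T := hmono.injOn.mono fun r hr ↦ (hT01 hr).1
  have hder : ∀ r ∈ T, HasDerivWithinAt f (deriv f r) T r := fun r hr ↦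
    (hdiff r (hT01 hr)).hasDerivAt.hasDerivWithinAt
  have hemb := ContinuousOn.measurableEmbedding hTm
    (fun r hr ↦ (hder r hr).continuousWithinAt) hinj
  have hfT : MeasurableSet (f '' T) := by
    simpa [range_domRestrict] using hemb.measurableSet_range
  -- The density `η / f'` is carried to the image through `f⁻¹`. It stays Borel because a continuous
  -- injection of a Borel subset of the line is a measurable embedding.
  obtain ⟨ψ₀, hψ₀, hψ₀f⟩ := hemb.exists_measurable_extend
    (g := fun r : T ↦ e r * (ENNReal.ofReal (deriv f r))⁻¹)
    ((hem.mul ((measurable_deriv f).ennreal_ofReal.inv)).comp measurable_subtype_coe)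
    (fun _ ↦ inferInstance)
  replace hψ₀f : ∀ r ∈ T, ψ₀ (f r) = e r * (ENNReal.ofReal (deriv f r))⁻¹ := fun r hr ↦
    congrFun hψ₀f ⟨r, hr⟩
  -- The extension `ψ₀` is arbitrary off `f '' T`; cutting it off there keeps the integral of `ψ ^
  -- n` under control.
  set ψ := (f '' T).indicator ψ₀ with hψ
  have hψm : Measurable ψ := hψ₀.indicator hfT
  have hone : 1 ≤ ∫⁻ s in Ioo (f r₁) (f r₂), ψ s := by
    calc
      1 ≤ ∫⁻ r in Ioo r₁ r₂, η r := hη1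
      _ = ∫⁻ r in Ioo r₁ r₂, e r := lintegral_congr_ae hη.ae_eq_mk
      _ = ∫⁻ r in T, e r := by rw [hTr]
      _ = ∫⁻ r in T, ENNReal.ofReal |deriv f r| * ψ₀ (f r) := by
        refine setLIntegral_congr_fun hTm fun r hr ↦ ?_
        have hd := hderiv r (hT01 hr)
        simp only [hψ₀f r hr]
        rw [abs_of_pos hd, mul_left_comm, ENNReal.mul_inv_cancel (by simpa using hd)
          ENNReal.ofReal_ne_top, mul_one]
      _ = ∫⁻ s in f '' T, ψ₀ s :=
        (lintegral_image_eq_lintegral_abs_deriv_mul hTm hder hinj _).symm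
      _ = ∫⁻ s in f '' T, ψ s := by rw [hψ, setLIntegral_indicator hfT, inter_self]
      _ ≤ ∫⁻ s in Ioo (f r₁) (f r₂), ψ s := by
        refine lintegral_mono_set ?_
        rintro _ ⟨r, hr, rfl⟩
        exact ⟨hmono hr₁01 (hT01 hr).1 hr.1.1, hmono (hT01 hr).1 hr₂01 hr.1.2⟩
  have hadm : Admissible (imageFamily g (joining E₁ E₂ (puncturedBall n))) fun y ↦ ψ ‖y‖ := by
    refine ⟨hψm.comp measurable_norm, ?_⟩
    rintro β ⟨γ, ⟨hγa, hγb, -⟩, ha, hb, hβ⟩ hlen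
    refine hone.trans (Curve.setLIntegral_Ioo_le_lineIntegral lipschitzWith_one_norm hlen ?_ ?_ hψm)
    · rw [ha, hβ _ γ.left_mem, hg _ (hE₁ hγa).2]
      refine hmono.monotoneOn (mem_puncturedBall_iff.1 (hE₁ hγa).2) hr₁01 ?_
      simpa using Metric.closure_ball_subset_closedBall (hE₁ hγa).1
    · rw [hb, hβ _ γ.right_mem, hg _ (hE₂ hγb).2]
      refine hmono.monotoneOn hr₂01 (mem_puncturedBall_iff.1 (hE₂ hγb).2) ?_
      simpa using (hE₂ hγb).1
  refine iInf₂_le_of_le _ hadm ?_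
  simp only [ENNReal.rpow_natCast]
  have hdim : Module.finrank ℝ (EuclideanSpace ℝ (Fin n)) = n := by simp
  have hring : ∀ x : EuclideanSpace ℝ (Fin n),
      x ∈ openRing 0 r₁ r₂ ∩ puncturedBall n ↔ ‖x‖ ∈ Ioo r₁ r₂ := by
    intro x
    rw [mem_inter_iff, mem_puncturedBall_iff]
    simp only [openRing, dist_zero_right, mem_ofPred_eq, mem_Ioo]
    constructor
    · exact fun h ↦ h.1
    · exact fun h ↦ ⟨h, hr₁.trans h.1, h.2.trans hr₂⟩
  have hringm : MeasurableSet (openRing (0 : EuclideanSpace ℝ (Fin n)) r₁ r₂ ∩ puncturedBall n) := by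
    rw [show openRing (0 : EuclideanSpace ℝ (Fin n)) r₁ r₂ ∩ puncturedBall n =
      norm ⁻¹' Ioo r₁ r₂ from Set.ext hring]
    exact measurable_norm measurableSet_Ioo
  calc
    ∫⁻ y : EuclideanSpace ℝ (Fin n), ψ ‖y‖ ^ n
        = volume.toSphere univ * ∫⁻ s in Ioi (0 : ℝ), ENNReal.ofReal (s ^ (n - 1)) * ψ s ^ n := by
      rw [lintegral_fun_norm_addHaar volume (hψm.pow_const n), hdim]
    _ = volume.toSphere univ *
          ∫⁻ s in f '' T, ENNReal.ofReal (s ^ (n - 1)) * ψ₀ s ^ n := by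
      congr 1
      have hsub : f '' T ∩ Ioi 0 = f '' T := by
        refine inter_eq_left.2 ?_
        rintro _ ⟨r, hr, rfl⟩
        exact hf0 r (hT01 hr).1
      rw [← hsub, ← setLIntegral_indicator hfT]
      congr 1 with s
      by_cases hs : s ∈ f '' T <;> simp [hψ, hs, hn]
    _ = volume.toSphere univ * ∫⁻ r in T,
          ENNReal.ofReal |deriv f r| * (ENNReal.ofReal (f r ^ (n - 1)) * ψ₀ (f r) ^ n) := by
      rw [lintegral_image_eq_lintegral_abs_deriv_mul hTm hder hinj]
    -- The Jacobian `f'`, the area factor `f ^ (n - 1)` and `f' ^ (-n)` combine to `r ^ (n - 1)`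
    -- times the inner dilatation, which `q` dominates.
    _ ≤ volume.toSphere univ * ∫⁻ r in T,
          ENNReal.ofReal (r ^ (n - 1)) * (q r * e r ^ n) := by
      refine mul_le_mul_right (setLIntegral_mono' hTm fun r hr ↦ ?_) _
      rw [hψ₀f r hr, ofReal_mul_pow_mul_inv_pow hn (hT01 hr).1.1 (hf0 r (hT01 hr).1).le
        (hderiv r (hT01 hr))]
      gcongr
      exact hdil r (hT01 hr)
    _ = volume.toSphere univ * ∫⁻ r in Ioi (0 : ℝ),
          ENNReal.ofReal (r ^ (n - 1)) * (Ioo r₁ r₂).indicator (fun r ↦ q r * e r ^ n) r := by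
      have hsub : Ioo r₁ r₂ ∩ Ioi 0 = Ioo r₁ r₂ := inter_eq_left.2 fun r hr ↦ hr₁.trans hr.1
      rw [hTr]
      nth_rw 1 [← hsub]
      rw [← setLIntegral_indicator measurableSet_Ioo]
      congr 2 with r
      by_cases hr : r ∈ Ioo r₁ r₂ <;> simp only [hr, indicator_of_mem, indicator_of_notMem,
        not_false_eq_true, mul_zero]
    _ = ∫⁻ x : EuclideanSpace ℝ (Fin n), (Ioo r₁ r₂).indicator (fun r ↦ q r * e r ^ n) ‖x‖ := by
      have hm : Measurable fun r ↦ q r * e r ^ n := hq.mul (hem.pow_const n)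
      rw [lintegral_fun_norm_addHaar volume (hm.indicator measurableSet_Ioo), hdim]
    _ ≤ ∫⁻ x in openRing 0 r₁ r₂ ∩ puncturedBall n, Q x * η (dist x 0) ^ n := by
      rw [← lintegral_indicator hringm]
      refine lintegral_mono_ae ?_
      filter_upwards [ae_norm_of_ae volume hee] with x hx
      by_cases hxr : ‖x‖ ∈ Ioo r₁ r₂
      · have hxD := (hring x).2 hxr
        rw [indicator_of_mem hxr, indicator_of_mem hxD, dist_zero_right, hx hxr]
        gcongr
        exact hQ x hxD.2
      · simp [indicator_of_notMem hxr]


/-! ### The radial profile of the stretches -/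

/-- The action of `radialStretch α m` on the radii. -/
noncomputable def stretchProfile (α : ℝ) (m : ℕ+) (r : ℝ) : ℝ :=
  (1 + max r (1 / (m : ℝ)) ^ α) / max r (1 / (m : ℝ)) * r

section Profile

variable {α : ℝ} {m : ℕ+} {r : ℝ}

theorem breakRadius_pos (m : ℕ+) : 0 < 1 / (m : ℝ) :=
  one_div_pos.2 (Nat.cast_pos.2 m.pos)

theorem breakRadius_le_one (m : ℕ+) : 1 / (m : ℝ) ≤ 1 :=
  (div_le_one (Nat.cast_pos.2 m.pos)).2 (Nat.one_le_cast.2 m.pos)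

theorem stretchProfile_of_ge (h : 1 / (m : ℝ) ≤ r) : stretchProfile α m r = 1 + r ^ α := by
  rw [stretchProfile, max_eq_left h, div_mul_cancel₀ _ ((breakRadius_pos m).trans_le h).ne']

theorem stretchProfile_of_le (h : r ≤ 1 / (m : ℝ)) :
    stretchProfile α m r = (1 + (1 / (m : ℝ)) ^ α) / (1 / (m : ℝ)) * r := by
  rw [stretchProfile, max_eq_right h]

theorem stretchProfile_zero : stretchProfile α m 0 = 0 := mul_zero _

theorem stretchProfile_one : stretchProfile α m 1 = 2 := by
  rw [stretchProfile_of_ge (breakRadius_le_one m), Real.one_rpow, one_add_one_eq_two]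

theorem stretchSlope_pos (α : ℝ) (m : ℕ+) : 0 < (1 + (1 / (m : ℝ)) ^ α) / (1 / (m : ℝ)) := by
  have := Real.rpow_pos_of_pos (breakRadius_pos m) α
  have := breakRadius_pos m
  positivity

theorem strictMonoOn_stretchProfile (hα : 0 < α) :
    StrictMonoOn (stretchProfile α m) (Ici 0) := by
  rw [← Icc_union_Ici_eq_Ici (breakRadius_pos m).le]
  refine StrictMonoOn.union ?_ ?_ (isGreatest_Icc (breakRadius_pos m).le) isLeast_Ici
  · intro r hr s hs hrs
    rw [stretchProfile_of_le hr.2, stretchProfile_of_le hs.2]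
    exact mul_lt_mul_of_pos_left hrs (stretchSlope_pos α m)
  · intro r hr s hs hrs
    rw [stretchProfile_of_ge hr, stretchProfile_of_ge hs]
    gcongr
    exact (breakRadius_pos m).le.trans hr

theorem stretchProfile_pos (hα : 0 < α) (hr : 0 < r) : 0 < stretchProfile α m r :=
  stretchProfile_zero (α := α) (m := m) ▸
    strictMonoOn_stretchProfile hα self_mem_Ici hr.le hr

/-- The maximum merges the two branches into one formula and keeps the base of the power and the
denominator away from 0, so there is no singularity at the origin. -/
theorem continuous_stretchFactor {X : Type*} [TopologicalSpace X] {h : X → ℝ} (hh : Continuous h)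
    (α : ℝ) (m : ℕ+) :
    Continuous fun x ↦ (1 + max (h x) (1 / (m : ℝ)) ^ α) / max (h x) (1 / (m : ℝ)) := by
  have hpos : ∀ x, max (h x) (1 / (m : ℝ)) ≠ 0 := fun x ↦
    ((breakRadius_pos m).trans_le (le_max_right _ _)).ne'
  have hmax : Continuous fun x ↦ max (h x) (1 / (m : ℝ)) := hh.max continuous_const
  exact (continuous_const.add (hmax.rpow_const fun x ↦ .inl (hpos x))).div hmax hpos

theorem continuous_stretchProfile : Continuous (stretchProfile α m) :=
  (continuous_stretchFactor continuous_id α m).mul continuous_id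

theorem tendsto_stretchProfile_atTop (hα : 0 < α) : Tendsto (stretchProfile α m) atTop atTop := by
  refine (tendsto_atTop_add_const_left _ 1 (tendsto_rpow_atTop hα)).congr' ?_
  filter_upwards [eventually_ge_atTop (1 / (m : ℝ))] with r hr
  exact (stretchProfile_of_ge hr).symm

theorem hasDerivAt_stretchProfile_of_lt (h : r < 1 / (m : ℝ)) :
    HasDerivAt (stretchProfile α m) ((1 + (1 / (m : ℝ)) ^ α) / (1 / (m : ℝ))) r := by
  refine (hasDerivAt_const_mul _).congr_of_eventuallyEq ?_
  filter_upwards [eventually_lt_nhds h] with s hs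
  exact stretchProfile_of_le hs.le

theorem hasDerivAt_stretchProfile_of_gt (h : 1 / (m : ℝ) < r) :
    HasDerivAt (stretchProfile α m) (α * r ^ (α - 1)) r := by
  refine ((Real.hasDerivAt_rpow_const (.inl ((breakRadius_pos m).trans h).ne')).const_add
    1).congr_of_eventuallyEq ?_
  filter_upwards [eventually_gt_nhds h] with s hs
  exact stretchProfile_of_ge hs.le

end Profile

/-! ### The weight and its integrability -/

/-- A radial weight that dominates the inner dilatation of all the maps `radialStretch α m`. -/
noncomputable def stretchWeight (n : ℕ) (α r : ℝ) : ℝ≥0∞ :=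
  (ENNReal.ofReal (2 / α) / ENNReal.ofReal r ^ α) ^ (n - 1)

section Weight

variable {n : ℕ} {α r : ℝ}

theorem measurable_stretchWeight : Measurable (stretchWeight n α) := by
  unfold stretchWeight
  fun_prop

theorem stretchWeight_of_pos (hα : 0 < α) (hr : 0 < r) :
    stretchWeight n α r = ENNReal.ofReal ((2 / (α * r ^ α)) ^ (n - 1)) := by
  have := Real.rpow_pos_of_pos hr α
  rw [stretchWeight, ENNReal.ofReal_rpow_of_pos hr, ← ENNReal.ofReal_div_of_pos this,
    ENNReal.ofReal_pow (by positivity), div_div]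

/-- The base `2 / (α r ^ α)` is at least 1 because `r ^ α ≤ 1` and `α < 1`. Division in `ℝ≥0∞` makes
the base infinite at `r = 0`, so the centre of the ball is covered. -/
theorem one_le_stretchWeight (hα : 0 < α) (hα1 : α < 1) (hr : r ≤ 1) :
    1 ≤ stretchWeight n α r := by
  refine one_le_pow₀ ?_
  rw [ENNReal.le_div_iff_mul_le (.inr (by simp [hα])) (.inr ENNReal.ofReal_ne_top), one_mul]
  refine (ENNReal.rpow_le_one (ENNReal.ofReal_le_one.2 hr) hα.le).trans ?_
  rw [ENNReal.one_le_ofReal, le_div_iff₀ hα]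
  linarith

/-- The inner dilatation of `radialStretch α m` is at most `stretchWeight n α`. -/
theorem ofReal_stretchProfile_div_le_stretchWeight {m : ℕ+} (hα : 0 < α) (hα1 : α < 1)
    (hr : r ∈ Ioo (0 : ℝ) 1) (hrm : r ≠ 1 / (m : ℝ)) :
    ENNReal.ofReal
      ((stretchProfile α m r / (r * deriv (stretchProfile α m) r)) ^ (n - 1)) ≤
        stretchWeight n α r := by
  rcases hrm.lt_or_gt with h | h
  -- On the linear part the dilatation is exactly 1.
  · rw [(hasDerivAt_stretchProfile_of_lt h).deriv, stretchProfile_of_le h.le, mul_comm r,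
      div_self (mul_pos (stretchSlope_pos α m) hr.1).ne', one_pow, ENNReal.ofReal_one]
    exact one_le_stretchWeight hα hα1 hr.2.le
  -- Here `r f' r = α r ^ α`, and the numerator `1 + r ^ α` is at most 2.
  · have hpos := Real.rpow_pos_of_pos hr.1 α
    have hle := Real.rpow_le_one hr.1.le hr.2.le hα.le
    rw [(hasDerivAt_stretchProfile_of_gt h).deriv, stretchProfile_of_ge h.le,
      stretchWeight_of_pos hα hr.1, mul_left_comm, ← Real.rpow_one_add' hr.1.le (by simpa using hα.ne'),
      add_sub_cancel]
    gcongr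
    linarith

/-- Integrability of the weight; the exponent `α` is half of `1 / p`. -/
theorem memLp_stretchWeight (hn : n ≠ 0) {p : ℝ} (hp : 0 < p) :
    MemLp (fun x : EuclideanSpace ℝ (Fin n) ↦ stretchWeight n (1 / (2 * p)) ‖x‖)
      (ENNReal.ofReal p) (volume.restrict (Metric.ball 0 1)) := by
  have : Nonempty (Fin n) := ⟨⟨0, Nat.pos_of_ne_zero hn⟩⟩
  refine ⟨(measurable_stretchWeight.comp measurable_norm).aestronglyMeasurable, ?_⟩
  rw [eLpNorm_lt_top_iff_lintegral_rpow_enorm_lt_top (by simpa using hp) ENNReal.ofReal_ne_top,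
    ENNReal.toReal_ofReal hp.le]
  simp only [enorm_eq_self]
  set A := ENNReal.ofReal (2 / (1 / (2 * p))) with hA
  -- Since `α p = 1 / 2`, the radial integrand is `(A ^ p * r / r ^ (1 / 2)) ^ (n - 1)`, and `r ≤ r
  -- ^ (1 / 2)` on the unit interval. The area factor thus absorbs the singularity and leaves a
  -- bounded integrand.
  have hbound : ∀ r ∈ Ioo (0 : ℝ) 1,
      ENNReal.ofReal (r ^ (n - 1)) * stretchWeight n (1 / (2 * p)) r ^ p ≤ (A ^ p) ^ (n - 1) := by
    intro r hr
    have hcomm : ∀ x : ℝ≥0∞, (x ^ (n - 1)) ^ p = (x ^ p) ^ (n - 1) := fun x ↦ by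
      rw [← ENNReal.rpow_natCast, ← ENNReal.rpow_natCast, ← ENNReal.rpow_mul, ← ENNReal.rpow_mul,
        mul_comm]
    rw [stretchWeight, ← hA, ENNReal.ofReal_pow hr.1.le, hcomm, ← mul_pow]
    refine pow_le_pow_left' ?_ _
    rw [ENNReal.div_rpow_of_nonneg _ _ hp.le, ← ENNReal.rpow_mul,
      show 1 / (2 * p) * p = 1 / 2 by field_simp, mul_comm]
    have ht : ENNReal.ofReal r ≤ ENNReal.ofReal r ^ (1 / 2 : ℝ) := by
      conv_lhs => rw [← ENNReal.rpow_one (ENNReal.ofReal r)]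
      exact ENNReal.rpow_le_rpow_of_exponent_ge (ENNReal.ofReal_le_one.2 hr.2.le) (by norm_num)
    calc
      A ^ p / ENNReal.ofReal r ^ (1 / 2 : ℝ) * ENNReal.ofReal r
          ≤ A ^ p / ENNReal.ofReal r ^ (1 / 2 : ℝ) * ENNReal.ofReal r ^ (1 / 2 : ℝ) := by gcongr
      _ ≤ A ^ p := ENNReal.mul_le_of_le_div le_rfl
  calc
    ∫⁻ x in Metric.ball (0 : EuclideanSpace ℝ (Fin n)) 1, stretchWeight n (1 / (2 * p)) ‖x‖ ^ p
        = ∫⁻ x : EuclideanSpace ℝ (Fin n),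
          (Iio 1).indicator (fun r ↦ stretchWeight n (1 / (2 * p)) r ^ p) ‖x‖ := by
      rw [← lintegral_indicator measurableSet_ball]
      congr 1 with x
      by_cases hx : ‖x‖ < 1 <;> simp [indicator, hx]
    _ = volume.toSphere univ * ∫⁻ r in Ioi (0 : ℝ), ENNReal.ofReal (r ^ (n - 1)) *
          (Iio 1).indicator (fun r ↦ stretchWeight n (1 / (2 * p)) r ^ p) r := by
      rw [lintegral_fun_norm_addHaar volume
        ((measurable_stretchWeight.pow_const p).indicator measurableSet_Iio), finrank_euclideanSpace_fin]
    _ = volume.toSphere univ * ∫⁻ r in Ioo (0 : ℝ) 1, ENNReal.ofReal (r ^ (n - 1)) *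
          stretchWeight n (1 / (2 * p)) r ^ p := by
      rw [← Iio_inter_Ioi, ← setLIntegral_indicator measurableSet_Iio]
      congr 2 with r
      by_cases hr : r < 1 <;> simp [indicator, hr]
    _ ≤ volume.toSphere univ * ∫⁻ r in Ioo (0 : ℝ) 1, (A ^ p) ^ (n - 1) := by
      gcongr 1
      exact setLIntegral_mono' measurableSet_Ioo hbound
    _ < ∞ := by
      rw [setLIntegral_const, Real.volume_Ioo]
      refine ENNReal.mul_lt_top
        (measure_lt_top (volume : Measure (EuclideanSpace ℝ (Fin n))).toSphere univ) (ENNReal.mul_lt_top ?_ ENNReal.ofReal_lt_top)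
      exact ENNReal.pow_lt_top (ENNReal.rpow_lt_top_of_nonneg hp.le ENNReal.ofReal_ne_top)

end Weight

/-! ### The stretches as maps of the space -/

section Stretch

variable {n : ℕ} {α : ℝ} {m : ℕ+}

theorem radialStretch_eq (x : EuclideanSpace ℝ (Fin n)) :
    radialStretch α m x =
      ((1 + max ‖x‖ (1 / (m : ℝ)) ^ α) / max ‖x‖ (1 / (m : ℝ))) • x := by
  rw [radialStretch]
  split_ifs with h
  · rw [max_eq_left h]
  · rw [max_eq_right (not_le.1 h).le]

theorem stretchFactor_pos (x : EuclideanSpace ℝ (Fin n)) :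
    0 < (1 + max ‖x‖ (1 / (m : ℝ)) ^ α) / max ‖x‖ (1 / (m : ℝ)) := by
  have hpos : 0 < max ‖x‖ (1 / (m : ℝ)) := (breakRadius_pos m).trans_le (le_max_right _ _)
  have := Real.rpow_pos_of_pos hpos α
  positivity

theorem norm_radialStretch (x : EuclideanSpace ℝ (Fin n)) :
    ‖radialStretch α m x‖ = stretchProfile α m ‖x‖ := by
  rw [radialStretch_eq, norm_smul, Real.norm_of_nonneg (stretchFactor_pos x).le, stretchProfile]

theorem continuous_radialStretch : Continuous (radialStretch (n := n) α m) := by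
  rw [funext (radialStretch_eq (n := n))]
  exact (continuous_stretchFactor continuous_norm α m).smul continuous_id

theorem injective_radialStretch (hα : 0 < α) :
    Function.Injective (radialStretch (n := n) α m) := by
  intro x y hxy
  have hnorm : ‖x‖ = ‖y‖ := by
    refine (strictMonoOn_stretchProfile (m := m) hα).injOn (norm_nonneg x) (norm_nonneg y) ?_
    rw [← norm_radialStretch, ← norm_radialStretch, hxy]
  rw [radialStretch_eq, radialStretch_eq, ← hnorm] at hxy
  exact smul_right_injective _ (stretchFactor_pos x).ne' hxy

/-- The formula defines a continuous injection of the whole space whose norm tends to infinity; it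
is therefore proper, hence closed. This gives the embedding of the punctured ball by restriction. -/
theorem isClosedEmbedding_radialStretch (hα : 0 < α) :
    IsClosedEmbedding (radialStretch (n := n) α m) := by
  refine .of_continuous_injective_isClosedMap continuous_radialStretch
    (injective_radialStretch hα) (IsProperMap.isClosedMap ?_)
  refine isProperMap_iff_tendsto_cocompact.2 ⟨continuous_radialStretch, ?_⟩
  rw [← Metric.cobounded_eq_cocompact, ← tendsto_norm_atTop_iff_cobounded]
  simp only [norm_radialStretch]
  exact (tendsto_stretchProfile_atTop hα).comp tendsto_norm_cobounded_atTop

theorem image_radialStretch_puncturedBall (hα : 0 < α) :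
    radialStretch α m '' puncturedBall n = Metric.ball 0 2 \ {0} := by
  have hmono := strictMonoOn_stretchProfile (m := m) hα
  ext y
  have hy : y ∈ Metric.ball (0 : EuclideanSpace ℝ (Fin n)) 2 \ {0} ↔ ‖y‖ ∈ Ioo (0 : ℝ) 2 := by
    simp [and_comm]
  rw [hy]
  constructor
  · rintro ⟨x, hx, rfl⟩
    rw [mem_puncturedBall_iff] at hx
    rw [norm_radialStretch]
    exact ⟨stretchProfile_pos hα hx.1,
      stretchProfile_one (α := α) (m := m) ▸ hmono hx.1.le (mem_Ici.2 zero_le_one) hx.2⟩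
  · intro hy
    have hivt := intermediate_value_Ioo zero_le_one
      (continuous_stretchProfile (α := α) (m := m)).continuousOn
    rw [stretchProfile_zero, stretchProfile_one] at hivt
    -- The preimage of `y` lies on the ray through `y`, at the radius where the profile takes the
    -- value `‖y‖`.
    obtain ⟨r, hr, hry⟩ := hivt hy
    have hnorm : ‖(r / ‖y‖) • y‖ = r := by
      rw [norm_smul, Real.norm_of_nonneg (div_nonneg hr.1.le (norm_nonneg y)),
        div_mul_cancel₀ _ hy.1.ne']
    refine ⟨(r / ‖y‖) • y, mem_puncturedBall_iff.2 (hnorm.symm ▸ hr), ?_⟩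
    rw [radialStretch_eq, hnorm, smul_smul, ← mul_div_assoc]
    change (stretchProfile α m r / ‖y‖) • y = y
    rw [hry, div_self hy.1.ne', one_smul]

theorem isRingQHomeoAt_radialStretch (hn : n ≠ 0) (hα : 0 < α) (hα1 : α < 1) :
    IsRingQHomeoAt (fun x ↦ stretchWeight n α ‖x‖) (puncturedBall n) (radialStretch α m) 0 := by
  refine ⟨(isClosedEmbedding_radialStretch hα).isEmbedding.comp .subtypeVal, ?_⟩
  have hder : ∀ r ∈ Ioo (0 : ℝ) 1 \ {1 / (m : ℝ)}, ∃ d, 0 < d ∧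
      HasDerivAt (stretchProfile α m) d r := by
    intro r hr
    rcases (show r ≠ 1 / (m : ℝ) from hr.2).lt_or_gt with h | h
    · exact ⟨_, stretchSlope_pos α m, hasDerivAt_stretchProfile_of_lt h⟩
    · exact ⟨_, mul_pos hα (Real.rpow_pos_of_pos hr.1.1 _), hasDerivAt_stretchProfile_of_gt h⟩
  -- The only exceptional radius is `1 / m`, where the two branches meet.
  refine isRingMapAt_of_radial hn (countable_singleton (1 / (m : ℝ)))
    (fun x _ ↦ norm_radialStretch x) (fun r hr ↦ stretchProfile_pos hα hr.1)
    ((strictMonoOn_stretchProfile hα).mono fun r hr ↦ hr.1.le) (fun r hr ↦ ?_) (fun r hr ↦ ?_)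
    measurable_stretchWeight (fun _ _ ↦ le_rfl) fun r hr ↦
    ofReal_stretchProfile_div_le_stretchWeight hα hα1 hr.1 hr.2
  · obtain ⟨d, -, hd⟩ := hder r hr
    exact hd.differentiableAt
  · obtain ⟨d, hd0, hd⟩ := hder r hr
    rwa [hd.deriv]

/-- Each map fixes 0 but gives points of norm `1 / m` the norm `1 + (1 / m) ^ α > 1`, so no `δ`
serves all `m` for `ε = 1`. -/
theorem not_equicontinuousAt_radialStretch (hn : n ≠ 0) :
    ¬ EquicontinuousAt (fun m : ℕ+ ↦ radialStretch (n := n) α m) 0 := by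
  have : Nonempty (Fin n) := ⟨⟨0, Nat.pos_of_ne_zero hn⟩⟩
  intro h
  obtain ⟨δ, hδ, hδ1⟩ := Metric.equicontinuousAt_iff.1 h 1 one_pos
  obtain ⟨k, hk⟩ := exists_nat_one_div_lt hδ
  obtain ⟨x, hx⟩ := exists_norm_eq (EuclideanSpace ℝ (Fin n)) (breakRadius_pos k.succPNat).le
  have hlt := hδ1 x (by simpa [hx] using hk) k.succPNat
  have h0 : radialStretch α k.succPNat (0 : EuclideanSpace ℝ (Fin n)) = 0 := by
    rw [radialStretch_eq, smul_zero]
  rw [h0, dist_zero_left, norm_radialStretch, hx, stretchProfile_of_ge le_rfl] at hlt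
  linarith [Real.rpow_pos_of_pos (breakRadius_pos k.succPNat) α]

end Stretch

end RingHomeo


/-! ### The counterexample -/

theorem mainTheorem4 (n : ℕ) (hn : 2 ≤ n) (p : ℝ) (hp : 1 ≤ p) :
    ∃ (Q : EuclideanSpace ℝ (Fin n) → ℝ≥0∞)
      (g : ℕ+ → EuclideanSpace ℝ (Fin n) → EuclideanSpace ℝ (Fin n)),
      (∀ x ∈ Metric.ball (0 : EuclideanSpace ℝ (Fin n)) 1, 1 ≤ Q x) ∧
      MemLp Q (ENNReal.ofReal p)
        (volume.restrict (Metric.ball (0 : EuclideanSpace ℝ (Fin n)) 1)) ∧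
      (∃ α : ℝ, 0 < α ∧ α < 1 ∧
        ∀ m, EqOn (g m) (RingHomeo.radialStretch α m) (RingHomeo.puncturedBall n)) ∧
      (∀ m, RingHomeo.IsRingQHomeoAt Q (RingHomeo.puncturedBall n) (g m) 0) ∧
      (∀ m, g m '' RingHomeo.puncturedBall n = Metric.ball 0 2 \ {0}) ∧
      ∃ G : ℕ+ → EuclideanSpace ℝ (Fin n) → EuclideanSpace ℝ (Fin n),
        (∀ m, EqOn (G m) (g m) (RingHomeo.puncturedBall n) ∧
          ContinuousOn (G m) (Metric.ball 0 1)) ∧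
        ¬ EquicontinuousAt G 0 := by
  have hn0 : n ≠ 0 := by omega
  have hp0 : 0 < p := one_pos.trans_le hp
  have hα : 0 < 1 / (2 * p) := by positivity
  have hα1 : 1 / (2 * p) < 1 := by
    rw [div_lt_one (by positivity)]
    linarith
  -- The exponent `α = 1 / (2p)` gives both `α < 1` and integrability of `Q ^ p`. The formula for
  -- the stretch is already continuous at 0, so the extension `G` is the same map.
  refine ⟨fun x ↦ RingHomeo.stretchWeight n (1 / (2 * p)) ‖x‖,
    fun m ↦ RingHomeo.radialStretch (1 / (2 * p)) m, fun x hx ↦ ?_,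
    RingHomeo.memLp_stretchWeight hn0 hp0, ⟨1 / (2 * p), hα, hα1, fun m ↦ eqOn_refl _ _⟩,
    fun m ↦ RingHomeo.isRingQHomeoAt_radialStretch hn0 hα hα1,
    fun m ↦ RingHomeo.image_radialStretch_puncturedBall hα,
    fun m ↦ RingHomeo.radialStretch (1 / (2 * p)) m,
    fun m ↦ ⟨eqOn_refl _ _, RingHomeo.continuous_radialStretch.continuousOn⟩,
    RingHomeo.not_equicontinuousAt_radialStretch hn0⟩
  exact RingHomeo.one_le_stretchWeight hα hα1 (by simpa using (mem_ball_zero_iff.1 hx).le)
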